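/- Let $n\ge 1$ and let $Z$ be a finite non-negative Borel measure on the unit sphere $S^{n-1}\subset\mathbb{R}^n$ that is isotropic, i.e. $|x|^2=\int_{S^{n-1}}|x\cdot u|^2\,dZ(u)$ for all $x\in\mathbb{R}^n$, and whose centroid $\frac{1}{Z(S^{n-1})}\int_{S^{n-1}}u\,dZ(u)$ is the origin. Let $Z_\infty=\operatorname{conv}(\operatorname{supp} Z)$ and let $Z_\infty^*=\{x\in\mathbb{R}^n : x\cdot v\le 1 \text{ for all } v\in Z_\infty\}$ be its polar body. Then the $n$-dimensional volume of $Z_\infty^*$ satisfies $$|Z_\infty^*|\le \frac{n^{n/2}(n+1)^{(n+1)/2}}{n!},$$ with equality if and only if $Z_\infty$ is a regular simplex inscribed in $S^{n-1}$ (that is, the convex hull of the $n+1$ vertices of a regular $n$-simplex, all of which lie on $S^{n-1}$). -/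

import Mathlib

open MeasureTheory

noncomputable section

namespace SphereMeasure

/-- A finite Borel measure `Z` on the unit sphere of `ℝⁿ` is isotropic if
`|x|² = ∫ |x · u|² dZ(u)` for every `x ∈ ℝⁿ`. -/
def IsIsotropic {n : ℕ} (Z : Measure (Metric.sphere (0 : EuclideanSpace ℝ (Fin n)) 1)) : Prop :=
  ∀ x : EuclideanSpace ℝ (Fin n),
    ‖x‖ ^ 2 = ∫ u, |inner ℝ x (u : EuclideanSpace ℝ (Fin n))| ^ 2 ∂Z

/-- The centroid `Z(S)⁻¹ ∫ u dZ(u)` of a finite Borel measure on the unit sphere `S` of `ℝⁿ`. -/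
def centroid {n : ℕ} (Z : Measure (Metric.sphere (0 : EuclideanSpace ℝ (Fin n)) 1)) :
    EuclideanSpace ℝ (Fin n) :=
  (Z.real Set.univ)⁻¹ • ∫ u, (u : EuclideanSpace ℝ (Fin n)) ∂Z

/-- The convex hull in `ℝⁿ` of the support of `Z`. -/
def hullSupport {n : ℕ} (Z : Measure (Metric.sphere (0 : EuclideanSpace ℝ (Fin n)) 1)) :
    Set (EuclideanSpace ℝ (Fin n)) :=
  convexHull ℝ ((fun u => (u : EuclideanSpace ℝ (Fin n))) '' Z.support)

end SphereMeasure

/-- The polar `{x | x · v ≤ 1 for all v ∈ K}` of a set `K ⊆ ℝⁿ` (one-sided, no absolute value). -/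
def polarBody {n : ℕ} (K : Set (EuclideanSpace ℝ (Fin n))) : Set (EuclideanSpace ℝ (Fin n)) :=
  {x | ∀ v ∈ K, inner ℝ x v ≤ 1}

/-- Taking the convex hull does not change the polar, so the polar of `conv (supp Z)` is
`{x | x · v ≤ 1 for all v ∈ supp Z}`. -/
theorem polarBody_convexHull {n : ℕ} (S : Set (EuclideanSpace ℝ (Fin n))) :
    polarBody (convexHull ℝ S) = polarBody S := by
  ext x
  refine ⟨fun h v hv => h v (subset_convexHull ℝ S hv), fun h v hv => ?_⟩
  have hc : Convex ℝ {v : EuclideanSpace ℝ (Fin n) | inner ℝ x v ≤ 1} :=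
    convex_halfSpace_le (innerSL ℝ x).toLinearMap.isLinear 1
  exact convexHull_min (fun w hw => h w hw) hc hv

/-- `K` is a regular `n`-simplex inscribed in the unit sphere of `ℝⁿ`: the convex hull of the
vertices of a regular `n`-simplex, all of whose vertices lie on the sphere. -/
def IsInscribedRegularSimplex {n : ℕ} (K : Set (EuclideanSpace ℝ (Fin n))) : Prop :=
  ∃ s : Affine.Simplex ℝ (EuclideanSpace ℝ (Fin n)) n,
    s.Regular ∧ (∀ i, s.points i ∈ Metric.sphere (0 : EuclideanSpace ℝ (Fin n)) 1) ∧
      K = convexHull ℝ (Set.range s.points)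

end

noncomputable section

open Real Set Filter Topology
open scoped Pointwise

set_option linter.unusedSectionVars false

/-! The proof turns the volume bound into an integral inequality in one dimension more. Each `u` in
`supp Z` is lifted to the unit vector `w = (-√n u, 1) / √(n + 1)` of `ℝⁿ × ℝ`. Isotropy together
with the vanishing centroid makes the `w` isotropic for `((n + 1) / n) Z`. The dual cone `{x | x · w
> 0}` has as slice at height `r > 0` the dilate by `r / √n` of the interior of the polar body, so
the integral of `exp (-x · ∫ w)` over the cone equals the volume of the polar divided by the claimed
bound. It remains to show that this integral is at most `1` (`lintegral_dualCone_le_one`).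

This is a reverse Brascamp-Lieb type estimate, proved by transport. Let `φ` carry the exponential
law to the Gaussian `exp (-π s²)`, so `φ' exp (-π φ²) = exp (-t)`, and put `T x = ∫ φ(x · w) w`.
Then `T` is injective, `det dT ≥ exp ∫ log φ'(x · w)` (`exp_integral_log_le_det`), and `‖T x‖² ≤ ∫
φ(x · w)²` (`norm_integral_smul_sq_le`). Changing variables bounds the integral by the total
Gaussian mass `1`.

Equality forces `φ(x · w) = T x · w` for every lifted vector; differentiating and using the symmetry
of `dT` shows that distinct lifted vectors are orthogonal. They then form an orthonormal basis,
which means that `supp Z` is the vertex set of a regular simplex. Conversely, for an orthonormal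
basis the cone is an orthant and the integral is exactly `1`. -/

/-! ### Transport from the exponential to the Gaussian law. -/

/-- The cumulative distribution function of the density `exp (-π x ^ 2)`. -/
def gaussianCDF (s : ℝ) : ℝ := ∫ x in Iic s, exp (-π * x ^ 2)

theorem integrable_exp_neg_pi_mul_sq : Integrable fun x : ℝ => exp (-π * x ^ 2) :=
  integrable_exp_neg_mul_sq pi_pos

theorem hasStrictDerivAt_gaussianCDF (s : ℝ) :
    HasStrictDerivAt gaussianCDF (exp (-π * s ^ 2)) s := by
  have hi := integrable_exp_neg_pi_mul_sq
  have h : gaussianCDF = fun s => gaussianCDF 0 + ∫ x in (0 : ℝ)..s, exp (-π * x ^ 2) := by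
    funext s
    rw [← intervalIntegral.integral_Iic_sub_Iic hi.integrableOn hi.integrableOn]
    simp [gaussianCDF]
  rw [h]
  have hc : Continuous fun x : ℝ => exp (-π * x ^ 2) := by fun_prop
  exact (hc.integral_hasStrictDerivAt 0 s).const_add _

theorem strictMono_gaussianCDF : StrictMono gaussianCDF :=
  strictMono_of_hasDerivAt_pos (fun s => (hasStrictDerivAt_gaussianCDF s).hasDerivAt)
    fun _ => exp_pos _

theorem tendsto_gaussianCDF_atTop : Tendsto gaussianCDF atTop (𝓝 1) := by
  have h := (aecover_Iic (μ := (volume : Measure ℝ)) (b := fun s : ℝ => s) tendsto_id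
    ).integral_tendsto_of_countably_generated integrable_exp_neg_pi_mul_sq
  rwa [integral_gaussian, div_self pi_pos.ne', sqrt_one] at h

theorem tendsto_gaussianCDF_atBot : Tendsto gaussianCDF atBot (𝓝 0) := by
  have h := tendsto_gaussianCDF_atTop.comp tendsto_neg_atBot_atTop
  have h2 : gaussianCDF = fun s => 1 - gaussianCDF (-s) := by
    funext s
    have e : gaussianCDF (-s) = ∫ x in Ioi s, exp (-π * x ^ 2) := by
      have := integral_comp_neg_Iic (-s) fun x : ℝ => exp (-π * x ^ 2)
      simpa [gaussianCDF] using this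
    have := integral_add_compl (measurableSet_Iic (a := s)) integrable_exp_neg_pi_mul_sq
    rw [integral_gaussian, div_self pi_pos.ne', sqrt_one, compl_Iic] at this
    rw [e, ← this]
    simp [gaussianCDF]
  rw [h2]
  simpa using h.const_sub 1

theorem gaussianCDF_pos (s : ℝ) : 0 < gaussianCDF s :=
  lt_of_le_of_lt
    (strictMono_gaussianCDF.monotone.le_of_tendsto tendsto_gaussianCDF_atBot (s - 1))
    (strictMono_gaussianCDF (by linarith))

theorem exists_gaussianCDF_eq {y : ℝ} (h0 : 0 < y) (h1 : y < 1) : ∃ s, gaussianCDF s = y := by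
  have hc : Continuous gaussianCDF :=
    continuous_iff_continuousAt.2 fun s => (hasStrictDerivAt_gaussianCDF s).hasDerivAt.continuousAt
  exact mem_range_of_exists_le_of_exists_ge hc
    ((tendsto_gaussianCDF_atBot.eventually_lt_const h0).exists.imp fun _ h => h.le)
    ((tendsto_gaussianCDF_atTop.eventually_const_lt h1).exists.imp fun _ h => h.le)

/-- The monotone map that transports the standard exponential distribution to the Gaussian
density `exp (-π x ^ 2)`. -/
theorem exists_transport_exponential_gaussian :
    ∃ φ : ℝ → ℝ, (∀ t, 0 < t → HasDerivAt φ (exp (-t + π * φ t ^ 2)) t) ∧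
      Tendsto φ (𝓝[>] 0) atBot := by
  -- The value at `t ≤ 0` is arbitrary; only positive arguments occur on the dual cone.
  have hex : ∀ t : ℝ, ∃ s, 0 < t → gaussianCDF s = 1 - exp (-t) := by
    intro t
    by_cases ht : 0 < t
    · obtain ⟨s, hs⟩ := exists_gaussianCDF_eq (y := 1 - exp (-t))
        (by simpa using ht) (by simpa using exp_pos (-t))
      exact ⟨s, fun _ => hs⟩
    · exact ⟨0, fun h => absurd h ht⟩
  choose φ hφ using hex
  refine ⟨φ, fun t ht => ?_, ?_⟩
  -- Near `t`, `φ` is the local inverse of `gaussianCDF` composed with `1 - exp (-t)`.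
  · have hd := hasStrictDerivAt_gaussianCDF (φ t)
    have hne : exp (-π * φ t ^ 2) ≠ 0 := (exp_pos _).ne'
    have hl := (hd.to_localInverse hne).hasDerivAt
    have hr := hd.eventually_right_inverse hne
    rw [hφ t ht] at hl
    rw [hφ t ht] at hr
    have he : HasDerivAt (fun t : ℝ => 1 - exp (-t)) (exp (-t)) t := by
      have := ((hasDerivAt_neg t).exp).const_sub 1
      simpa using this
    have hcomp := HasDerivAt.comp t hl he
    have hev : φ =ᶠ[𝓝 t] hd.localInverse gaussianCDF _ _ hne ∘ fun t : ℝ => 1 - exp (-t) := by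
      filter_upwards [he.continuousAt.eventually hr, lt_mem_nhds ht] with s hs hs0
      exact strictMono_gaussianCDF.injective ((hφ s hs0).trans hs.symm)
    have := hcomp.congr_of_eventuallyEq hev
    convert! this using 1
    rw [← exp_neg, ← exp_add]
    ring_nf
  · rw [tendsto_atBot]
    intro b
    have hlim : Tendsto (fun t : ℝ => 1 - exp (-t)) (𝓝[>] 0) (𝓝 0) := by
      have : ContinuousAt (fun t : ℝ => 1 - exp (-t)) 0 := by fun_prop
      have h := this.tendsto
      simp only [neg_zero, exp_zero, sub_self] at h
      exact h.mono_left nhdsWithin_le_nhds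
    filter_upwards [hlim.eventually_lt_const (gaussianCDF_pos b), self_mem_nhdsWithin] with t h1 h2
    rw [← hφ t h2] at h1
    exact (strictMono_gaussianCDF.lt_iff_lt.1 h1).le

/-! ### Dual cones and isotropic families of vectors. -/

section DualCone

variable {Ω E : Type*} [NormedAddCommGroup E] [InnerProductSpace ℝ E] {w : Ω → E}

/-- The open dual cone of a family of vectors. -/
def dualCone (w : Ω → E) : Set E := {x | ∀ ω, 0 < inner ℝ x (w ω)}

/-- The complement is the projection of a closed set along the compact factor `Ω`. -/
theorem isOpen_dualCone [TopologicalSpace Ω] [CompactSpace Ω] (hw : Continuous w) : IsOpen (dualCone w) := by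
  have h : dualCone w = (Prod.fst '' {p : E × Ω | inner ℝ p.1 (w p.2) ≤ 0})ᶜ := by
    ext x
    simp [dualCone]
  rw [h, isOpen_compl_iff]
  exact isClosedMap_fst_of_compactSpace _
    (isClosed_le (by fun_prop) continuous_const)

end DualCone

section IsotropicFamily

variable {Ω E F : Type*} [TopologicalSpace Ω] [CompactSpace Ω] [SecondCountableTopology Ω]
  [MeasurableSpace Ω] [BorelSpace Ω] {μ : Measure Ω} [IsFiniteMeasure μ]
  [NormedAddCommGroup E] [InnerProductSpace ℝ E] [FiniteDimensional ℝ E]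
  [NormedAddCommGroup F] [NormedSpace ℝ F]
  {w : Ω → E}

theorem integrable_of_continuous_compactSpace {f : Ω → F} (hf : Continuous f) :
    Integrable f μ := by
  obtain ⟨K, hK⟩ := isCompact_univ.exists_bound_of_continuousOn hf.continuousOn
  exact Integrable.of_bound hf.aestronglyMeasurable K (ae_of_all _ fun ω => hK ω (mem_univ ω))

theorem continuous_comp_inner_of_mem_dualCone (hw : Continuous w) {ψ : ℝ → ℝ}
    (hψ : ContinuousOn ψ (Ioi 0)) {x : E} (hx : x ∈ dualCone w) :
    Continuous fun ω => ψ (inner ℝ x (w ω)) :=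
  hψ.comp_continuous (by fun_prop) hx

/-- Differentiation under the integral; the dominating constant comes from compactness of a closed
ball in the cone times `Ω`. -/
theorem hasFDerivAt_integral_comp_inner (hw : Continuous w) {ψ ψ' : ℝ → ℝ}
    (hψ : ∀ t, 0 < t → HasDerivAt ψ (ψ' t) t) (hψ' : ContinuousOn ψ' (Ioi 0))
    {v : Ω → F} (hv : Continuous v) {x : E} (hx : x ∈ dualCone w) :
    HasFDerivAt (fun x => ∫ ω, ψ (inner ℝ x (w ω)) • v ω ∂μ)
      (∫ ω, ψ' (inner ℝ x (w ω)) • (innerSL ℝ (w ω)).smulRight (v ω) ∂μ) x := by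
  have hψc : ContinuousOn ψ (Ioi 0) := fun t ht => (hψ t ht).continuousAt.continuousWithinAt
  obtain ⟨ε, hε, hball⟩ := Metric.nhds_basis_closedBall.mem_iff.1
    ((isOpen_dualCone hw).mem_nhds hx)
  have hrank : Continuous fun ω => (innerSL ℝ (w ω)).smulRight (v ω) := by fun_prop
  have hcont : ContinuousOn (fun p : E × Ω =>
      ψ' (inner ℝ p.1 (w p.2)) • (innerSL ℝ (w p.2)).smulRight (v p.2))
      (Metric.closedBall x ε ×ˢ univ) := by
    refine ContinuousOn.smul (hψ'.comp (by fun_prop) fun p hp => ?_)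
      (hrank.comp continuous_snd).continuousOn
    exact hball hp.1 p.2
  obtain ⟨K, hK⟩ := ((isCompact_closedBall x ε).prod isCompact_univ).exists_bound_of_continuousOn
    hcont
  refine hasFDerivAt_integral_of_dominated_of_fderiv_le (s := Metric.closedBall x ε)
    (bound := fun _ => K)
    (F' := fun y ω => ψ' (inner ℝ y (w ω)) • (innerSL ℝ (w ω)).smulRight (v ω))
    (Metric.closedBall_mem_nhds x hε) ?_ ?_ ?_ ?_ ?_ ?_
  · filter_upwards [(isOpen_dualCone hw).mem_nhds hx] with y hy
    exact ((continuous_comp_inner_of_mem_dualCone hw hψc hy).smul hv).aestronglyMeasurable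
  · exact integrable_of_continuous_compactSpace
      ((continuous_comp_inner_of_mem_dualCone hw hψc hx).smul hv)
  · exact ((continuous_comp_inner_of_mem_dualCone hw hψ' hx).smul hrank).aestronglyMeasurable
  · exact ae_of_all _ fun ω y hy => hK (y, ω) ⟨hy, mem_univ _⟩
  · exact integrable_const K
  · refine ae_of_all _ fun ω y hy => ?_
    have hi : HasFDerivAt (fun y : E => inner ℝ y (w ω)) (innerSL ℝ (w ω)) y := by
      have := (innerSL ℝ (w ω)).hasFDerivAt (x := y)
      refine this.congr_of_eventuallyEq (Eventually.of_forall fun z => ?_)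
      simp [real_inner_comm]
    have h := ((hψ _ (hball hy ω)).comp_hasFDerivAt y hi).smul_const (v ω)
    convert! h using 1
    ext z
    simp [smul_smul]

/-- A family `w` of vectors is isotropic (in John's position) with respect to `μ` if
`∫ ⟪x, w⟫ ^ 2 dμ = ‖x‖ ^ 2` for all `x`. -/
def IsIsotropicFamily (μ : Measure Ω) (w : Ω → E) : Prop :=
  ∀ x : E, ∫ ω, inner ℝ x (w ω) ^ 2 ∂μ = ‖x‖ ^ 2

theorem inner_integral_smul (hw : Continuous w) {g : Ω → ℝ} (hg : Continuous g) (y : E) :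
    inner ℝ y (∫ ω, g ω • w ω ∂μ) = ∫ ω, g ω * inner ℝ y (w ω) ∂μ := by
  rw [← integral_inner (integrable_of_continuous_compactSpace (by fun_prop))]
  simp [inner_smul_right]

/-- Pythagoras in `L²(μ)`: isotropy makes `x ↦ ⟪x, w⟫` an isometric embedding with adjoint `g ↦ ∫ g
w`, so `⟪y, w⟫` below is the orthogonal projection of `g` onto its image. -/
theorem integral_sub_inner_sq (hw : Continuous w) (hiso : IsIsotropicFamily μ w) {g : Ω → ℝ}
    (hg : Continuous g) :
    ∫ ω, (g ω - inner ℝ (∫ η, g η • w η ∂μ) (w ω)) ^ 2 ∂μ =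
      ∫ ω, g ω ^ 2 ∂μ - ‖∫ ω, g ω • w ω ∂μ‖ ^ 2 := by
  set y := ∫ ω, g ω • w ω ∂μ with hy
  have h1 : ∫ ω, g ω * inner ℝ y (w ω) ∂μ = ‖y‖ ^ 2 := by
    rw [← inner_integral_smul hw hg, ← hy, real_inner_self_eq_norm_sq]
  have e : ∀ ω, (g ω - inner ℝ y (w ω)) ^ 2 =
      g ω ^ 2 - 2 * (g ω * inner ℝ y (w ω)) + inner ℝ y (w ω) ^ 2 := fun ω => by ring
  simp_rw [e]
  rw [integral_add, integral_sub, integral_const_mul, h1, hiso y]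
  · ring
  all_goals exact integrable_of_continuous_compactSpace (by fun_prop)

theorem norm_integral_smul_sq_le (hw : Continuous w) (hiso : IsIsotropicFamily μ w) {g : Ω → ℝ}
    (hg : Continuous g) : ‖∫ ω, g ω • w ω ∂μ‖ ^ 2 ≤ ∫ ω, g ω ^ 2 ∂μ := by
  have := integral_sub_inner_sq hw hiso hg
  have h0 : 0 ≤ ∫ ω, (g ω - inner ℝ (∫ η, g η • w η ∂μ) (w ω)) ^ 2 ∂μ :=
    integral_nonneg fun ω => sq_nonneg _
  linarith

theorem eq_inner_of_norm_integral_smul_sq_eq [μ.IsOpenPosMeasure] (hw : Continuous w)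
    (hiso : IsIsotropicFamily μ w) {g : Ω → ℝ} (hg : Continuous g)
    (h : ‖∫ ω, g ω • w ω ∂μ‖ ^ 2 = ∫ ω, g ω ^ 2 ∂μ) (ω : Ω) :
    g ω = inner ℝ (∫ η, g η • w η ∂μ) (w ω) := by
  have h0 := integral_sub_inner_sq hw hiso hg
  have hcont : Continuous fun ω => (g ω - inner ℝ (∫ η, g η • w η ∂μ) (w ω)) ^ 2 := by fun_prop
  rw [h, sub_self, integral_eq_zero_iff_of_nonneg (fun _ => sq_nonneg _)
    (integrable_of_continuous_compactSpace hcont)] at h0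
  have h1 := Continuous.ae_eq_iff_eq μ hcont continuous_const |>.1 h0
  have := congrFun h1 ω
  exact sub_eq_zero.1 (pow_eq_zero_iff two_ne_zero |>.1 this)

theorem inner_integral_rankOne_apply (hw : Continuous w) {c : Ω → ℝ} (hc : Continuous c)
    (x y : E) :
    inner ℝ y ((∫ ω, c ω • (innerSL ℝ (w ω)).smulRight (w ω) ∂μ) x) =
      ∫ ω, c ω * (inner ℝ x (w ω) * inner ℝ y (w ω)) ∂μ := by
  rw [ContinuousLinearMap.integral_apply (integrable_of_continuous_compactSpace (by fun_prop)),
    ← integral_inner (integrable_of_continuous_compactSpace (by fun_prop))]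
  refine integral_congr_ae (ae_of_all _ fun ω => ?_)
  simp [inner_smul_right, real_inner_comm]

theorem isSymmetric_integral_rankOne (hw : Continuous w) {c : Ω → ℝ} (hc : Continuous c) :
    ((∫ ω, c ω • (innerSL ℝ (w ω)).smulRight (w ω) ∂μ : E →L[ℝ] E) : E →ₗ[ℝ] E).IsSymmetric := by
  intro x y
  change inner ℝ ((∫ ω, c ω • (innerSL ℝ (w ω)).smulRight (w ω) ∂μ : E →L[ℝ] E) x) y =
    inner ℝ x ((∫ ω, c ω • (innerSL ℝ (w ω)).smulRight (w ω) ∂μ : E →L[ℝ] E) y)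
  rw [real_inner_comm, inner_integral_rankOne_apply hw hc, inner_integral_rankOne_apply hw hc]
  simp_rw [mul_comm (inner ℝ x _)]

/-- In an eigenbasis `b i`, each `⟪b i, w⟫² dμ` is a probability measure under which `c` has mean
the eigenvalue `l i`. Jensen for `log` and summation over `i`, with `∑ ⟪b i, w⟫² = 1`, give the
bound. -/
theorem exp_integral_log_le_det (hw : Continuous w) (hiso : IsIsotropicFamily μ w)
    (hunit : ∀ ω, ‖w ω‖ = 1) {c : Ω → ℝ} (hc : Continuous c) (hpos : ∀ ω, 0 < c ω) :
    exp (∫ ω, log (c ω) ∂μ) ≤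
      (∫ ω, c ω • (innerSL ℝ (w ω)).smulRight (w ω) ∂μ : E →L[ℝ] E).det := by
  set A : E →L[ℝ] E := ∫ ω, c ω • (innerSL ℝ (w ω)).smulRight (w ω) ∂μ with hA
  have hsym : (A : E →ₗ[ℝ] E).IsSymmetric := isSymmetric_integral_rankOne hw hc
  set d := Module.finrank ℝ E
  let b := hsym.eigenvectorBasis (n := d) rfl
  let l := hsym.eigenvalues (n := d) rfl
  have hlc : Continuous fun ω => log (c ω) := hc.log fun ω => (hpos ω).ne'
  have hl : ∀ i, ∫ ω, c ω * inner ℝ (b i) (w ω) ^ 2 ∂μ = l i := by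
    intro i
    have h := inner_integral_rankOne_apply (μ := μ) hw hc (b i) (b i)
    have e : A (b i) = l i • b i := hsym.apply_eigenvectorBasis rfl i
    rw [← hA, e, inner_smul_right, real_inner_self_eq_norm_sq, b.norm_eq_one] at h
    simp_rw [sq]
    linarith
  have hlog : ∀ i, 0 < l i ∧ ∫ ω, log (c ω) * inner ℝ (b i) (w ω) ^ 2 ∂μ ≤ log (l i) := by
    intro i
    have h1 : ∫ ω, inner ℝ (b i) (w ω) ^ 2 ∂μ = 1 := by
      rw [hiso, b.norm_eq_one]; norm_num
    have hb : Continuous fun ω => inner ℝ (b i) (w ω) ^ 2 := by fun_prop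
    have hcb : Continuous fun ω => c ω * inner ℝ (b i) (w ω) ^ 2 := by fun_prop
    have hli : 0 < l i := by
      rw [← hl i]
      refine (integral_pos_iff_support_of_nonneg (fun ω => mul_nonneg (hpos ω).le (sq_nonneg _))
        (integrable_of_continuous_compactSpace hcb)).2 ?_
      have h2 : 0 < ∫ ω, inner ℝ (b i) (w ω) ^ 2 ∂μ := by rw [h1]; norm_num
      rw [integral_pos_iff_support_of_nonneg (fun ω => sq_nonneg _)
        (integrable_of_continuous_compactSpace hb)] at h2
      convert! h2 using 2
      ext ω
      simp [(hpos ω).ne']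
    refine ⟨hli, ?_⟩
    calc ∫ ω, log (c ω) * inner ℝ (b i) (w ω) ^ 2 ∂μ
        ≤ ∫ ω, ((log (l i) - 1) * inner ℝ (b i) (w ω) ^ 2 +
            (l i)⁻¹ * (c ω * inner ℝ (b i) (w ω) ^ 2)) ∂μ := by
          refine integral_mono (integrable_of_continuous_compactSpace (by fun_prop))
            (integrable_of_continuous_compactSpace (by fun_prop)) fun ω => ?_
          -- Jensen through the tangent line of `log` at `l i`.
          have h3 := log_le_sub_one_of_pos (div_pos (hpos ω) hli)
          rw [log_div (hpos ω).ne' hli.ne'] at h3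
          have h4 : log (c ω) ≤ log (l i) - 1 + (l i)⁻¹ * c ω := by
            rw [inv_mul_eq_div]; linarith
          have := mul_le_mul_of_nonneg_right h4 (sq_nonneg (inner ℝ (b i) (w ω)))
          dsimp only
          linarith
      _ = log (l i) := by
          rw [integral_add (integrable_of_continuous_compactSpace (by fun_prop))
            (integrable_of_continuous_compactSpace (by fun_prop)), integral_const_mul,
            integral_const_mul, h1, hl i, inv_mul_cancel₀ hli.ne']
          ring
  have hdet : A.det = ∏ i, l i := hsym.det_eq_prod_eigenvalues rfl
  have hsum : ∫ ω, log (c ω) ∂μ = ∑ i, ∫ ω, log (c ω) * inner ℝ (b i) (w ω) ^ 2 ∂μ := by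
    rw [← integral_finsetSum _ fun i _ => integrable_of_continuous_compactSpace (by fun_prop)]
    refine integral_congr_ae (ae_of_all _ fun ω => ?_)
    have h := b.sum_sq_norm_inner_right (w ω)
    simp only [norm_eq_abs, sq_abs, hunit] at h
    simp only [← Finset.mul_sum]
    rw [h]; ring
  rw [hdet, hsum, exp_sum]
  refine Finset.prod_le_prod (fun i _ => (exp_pos _).le) fun i _ => ?_
  rw [← exp_log (hlog i).1]
  exact exp_le_exp.2 (hlog i).2

end IsotropicFamily

/-! ### The transport map, the integral inequality and its equality case. -/

section TransportMap

variable {Ω E : Type*} [TopologicalSpace Ω] [CompactSpace Ω] [SecondCountableTopology Ω]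
  [MeasurableSpace Ω] [BorelSpace Ω] {μ : Measure Ω} [IsFiniteMeasure μ]
  [NormedAddCommGroup E] [InnerProductSpace ℝ E] [FiniteDimensional ℝ E]
  {w : Ω → E} {φ : ℝ → ℝ}

/-- The transport map `x ↦ ∫ φ(⟪x, w⟫) w dμ`. -/
def transportMap (μ : Measure Ω) (w : Ω → E) (φ : ℝ → ℝ) (x : E) : E :=
  ∫ ω, φ (inner ℝ x (w ω)) • w ω ∂μ

/-- The derivative of `transportMap` for `φ' = exp (-t + π φ ^ 2)`. -/
def transportDeriv (μ : Measure Ω) (w : Ω → E) (φ : ℝ → ℝ) (x : E) : E →L[ℝ] E :=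
  ∫ ω, exp (-(inner ℝ x (w ω)) + π * φ (inner ℝ x (w ω)) ^ 2) •
    (innerSL ℝ (w ω)).smulRight (w ω) ∂μ

theorem continuousOn_of_transport (hφ : ∀ t, 0 < t → HasDerivAt φ (exp (-t + π * φ t ^ 2)) t) :
    ContinuousOn φ (Ioi 0) := fun t ht => (hφ t ht).continuousAt.continuousWithinAt

theorem continuousOn_deriv_of_transport
    (hφ : ∀ t, 0 < t → HasDerivAt φ (exp (-t + π * φ t ^ 2)) t) :
    ContinuousOn (fun t => exp (-t + π * φ t ^ 2)) (Ioi 0) := by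
  have := continuousOn_of_transport hφ
  fun_prop

theorem strictMonoOn_of_transport (hφ : ∀ t, 0 < t → HasDerivAt φ (exp (-t + π * φ t ^ 2)) t) :
    StrictMonoOn φ (Ioi 0) := by
  refine strictMonoOn_of_deriv_pos (convex_Ioi 0) (continuousOn_of_transport hφ) fun t ht => ?_
  rw [interior_Ioi] at ht
  rw [(hφ t ht).deriv]
  exact exp_pos _

theorem hasFDerivAt_transportMap (hw : Continuous w)
    (hφ : ∀ t, 0 < t → HasDerivAt φ (exp (-t + π * φ t ^ 2)) t) {x : E} (hx : x ∈ dualCone w) :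
    HasFDerivAt (transportMap μ w φ) (transportDeriv μ w φ x) x :=
  hasFDerivAt_integral_comp_inner hw hφ (continuousOn_deriv_of_transport hφ) hw hx

/-- Strict monotonicity: `⟪T x - T y, x - y⟫` integrates a nonnegative function that vanishes only
where `⟪x - y, w⟫ = 0`, and isotropy then gives `x = y`. -/
theorem injOn_transportMap (hw : Continuous w) (hiso : IsIsotropicFamily μ w)
    (hφ : ∀ t, 0 < t → HasDerivAt φ (exp (-t + π * φ t ^ 2)) t) :
    InjOn (transportMap μ w φ) (dualCone w) := by
  intro x hx y hy hxy
  have hcx := continuous_comp_inner_of_mem_dualCone hw (continuousOn_of_transport hφ) hx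
  have hcy := continuous_comp_inner_of_mem_dualCone hw (continuousOn_of_transport hφ) hy
  have hmono := strictMonoOn_of_transport hφ
  set f : Ω → ℝ := fun ω => (φ (inner ℝ x (w ω)) - φ (inner ℝ y (w ω))) * inner ℝ (x - y) (w ω)
    with hf
  have hu : Continuous fun ω => inner ℝ (x - y) (w ω) := by fun_prop
  have hfc : Continuous f := (hcx.sub hcy).mul hu
  have hsgn : ∀ ω, 0 ≤ f ω ∧ (f ω = 0 → inner ℝ (x - y) (w ω) = 0) := by
    intro ω
    simp only [hf, inner_sub_left]
    rcases lt_trichotomy (inner ℝ x (w ω)) (inner ℝ y (w ω)) with h | h | h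
    · have := hmono (hx ω) (hy ω) h
      have := mul_pos_of_neg_of_neg (sub_neg.2 this) (sub_neg.2 h)
      exact ⟨this.le, fun h0 => absurd h0 this.ne'⟩
    · simp [h]
    · have := hmono (hy ω) (hx ω) h
      have := mul_pos (sub_pos.2 this) (sub_pos.2 h)
      exact ⟨this.le, fun h0 => absurd h0 this.ne'⟩
  have hint : ∫ ω, f ω ∂μ = 0 := by
    have h1 := inner_integral_smul (μ := μ) hw hcx (x - y)
    have h2 := inner_integral_smul (μ := μ) hw hcy (x - y)
    change inner ℝ _ (transportMap μ w φ x) = _ at h1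
    change inner ℝ _ (transportMap μ w φ y) = _ at h2
    simp only [hf, sub_mul]
    have hmx : Continuous fun ω => φ (inner ℝ x (w ω)) * inner ℝ (x - y) (w ω) := hcx.mul hu
    have hmy : Continuous fun ω => φ (inner ℝ y (w ω)) * inner ℝ (x - y) (w ω) := hcy.mul hu
    rw [integral_sub (integrable_of_continuous_compactSpace hmx)
      (integrable_of_continuous_compactSpace hmy), ← h1, ← h2, hxy, sub_self]
  rw [integral_eq_zero_iff_of_nonneg (fun ω => (hsgn ω).1)
    (integrable_of_continuous_compactSpace hfc)] at hint
  have h0 : ∫ ω, inner ℝ (x - y) (w ω) ^ 2 ∂μ = 0 := by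
    refine integral_eq_zero_of_ae ?_
    filter_upwards [hint] with ω hω
    simp [(hsgn ω).2 hω]
  rw [hiso] at h0
  exact sub_eq_zero.1 (norm_eq_zero.1 (pow_eq_zero_iff two_ne_zero |>.1 h0))

theorem exp_neg_inner_le_det_mul (hw : Continuous w) (hiso : IsIsotropicFamily μ w)
    (hunit : ∀ ω, ‖w ω‖ = 1) (hφ : ∀ t, 0 < t → HasDerivAt φ (exp (-t + π * φ t ^ 2)) t)
    {x : E} (hx : x ∈ dualCone w) :
    0 < (transportDeriv μ w φ x).det ∧
    exp (-inner ℝ x (∫ ω, w ω ∂μ)) ≤ (transportDeriv μ w φ x).det *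
      exp (-π * ∫ ω, φ (inner ℝ x (w ω)) ^ 2 ∂μ) := by
  have hc := continuous_comp_inner_of_mem_dualCone hw (continuousOn_of_transport hφ) hx
  have hu : Continuous fun ω => inner ℝ x (w ω) := by fun_prop
  have hn : Continuous fun ω => -inner ℝ x (w ω) := hu.neg
  have hsq : Continuous fun ω => π * φ (inner ℝ x (w ω)) ^ 2 := (hc.pow 2).const_mul π
  have hdet := exp_integral_log_le_det (μ := μ) hw hiso hunit
    (c := fun ω => exp (-(inner ℝ x (w ω)) + π * φ (inner ℝ x (w ω)) ^ 2))
    (hn.add hsq).rexp fun ω => exp_pos _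
  change _ ≤ (transportDeriv μ w φ x).det at hdet
  refine ⟨(exp_pos _).trans_le hdet, ?_⟩
  refine le_trans (le_of_eq ?_) (mul_le_mul_of_nonneg_right hdet (exp_pos _).le)
  rw [← exp_add]
  simp only [log_exp]
  rw [integral_add (integrable_of_continuous_compactSpace hn)
    (integrable_of_continuous_compactSpace hsq), integral_const_mul,
    integral_neg,
    integral_inner (integrable_of_continuous_compactSpace hw)]
  ring_nf

theorem exp_neg_inner_le_transport (hw : Continuous w) (hiso : IsIsotropicFamily μ w)
    (hunit : ∀ ω, ‖w ω‖ = 1) (hφ : ∀ t, 0 < t → HasDerivAt φ (exp (-t + π * φ t ^ 2)) t)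
    {x : E} (hx : x ∈ dualCone w) :
    ENNReal.ofReal (exp (-inner ℝ x (∫ ω, w ω ∂μ))) ≤
      ENNReal.ofReal |(transportDeriv μ w φ x).det| *
        ENNReal.ofReal (exp (-π * ‖transportMap μ w φ x‖ ^ 2)) := by
  obtain ⟨hpos, hle⟩ := exp_neg_inner_le_det_mul hw hiso hunit hφ hx
  have hc := continuous_comp_inner_of_mem_dualCone hw (continuousOn_of_transport hφ) hx
  rw [← ENNReal.ofReal_mul (abs_nonneg _), abs_of_pos hpos]
  refine ENNReal.ofReal_le_ofReal (hle.trans (mul_le_mul_of_nonneg_left ?_ hpos.le))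
  refine exp_le_exp.2 ?_
  have := norm_integral_smul_sq_le hw hiso hc
  change ‖transportMap μ w φ x‖ ^ 2 ≤ _ at this
  nlinarith [pi_pos]

variable [MeasurableSpace E] [BorelSpace E]

theorem lintegral_exp_neg_pi_mul_norm_sq :
    ∫⁻ y : E, ENNReal.ofReal (exp (-π * ‖y‖ ^ 2)) = 1 := by
  have h := GaussianFourier.integral_rexp_neg_mul_sq_norm (V := E) pi_pos
  rw [div_self pi_pos.ne', one_rpow] at h
  have hi : Integrable fun y : E => exp (-π * ‖y‖ ^ 2) := by
    by_contra hn
    rw [integral_undef hn] at h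
    exact zero_ne_one h
  rw [← ofReal_integral_eq_lintegral_ofReal hi (ae_of_all _ fun y => (exp_pos _).le), h,
    ENNReal.ofReal_one]

theorem lintegral_transport_le_one (hw : Continuous w) (hiso : IsIsotropicFamily μ w)
    (hφ : ∀ t, 0 < t → HasDerivAt φ (exp (-t + π * φ t ^ 2)) t) :
    ∫⁻ x in dualCone w, ENNReal.ofReal |(transportDeriv μ w φ x).det| *
        ENNReal.ofReal (exp (-π * ‖transportMap μ w φ x‖ ^ 2)) ≤ 1 := by
  rw [← lintegral_image_eq_lintegral_abs_det_fderiv_mul volume (isOpen_dualCone hw).measurableSet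
    (fun x hx => (hasFDerivAt_transportMap hw hφ hx).hasFDerivWithinAt)
    (injOn_transportMap hw hiso hφ) (fun y => ENNReal.ofReal (exp (-π * ‖y‖ ^ 2))),
    ← lintegral_exp_neg_pi_mul_norm_sq (E := E)]
  exact setLIntegral_le_lintegral _ _

theorem lintegral_dualCone_le_one (hw : Continuous w) (hiso : IsIsotropicFamily μ w)
    (hunit : ∀ ω, ‖w ω‖ = 1) :
    ∫⁻ x in dualCone w, ENNReal.ofReal (exp (-inner ℝ x (∫ ω, w ω ∂μ))) ≤ 1 := by
  obtain ⟨φ, hφ, -⟩ := exists_transport_exponential_gaussian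
  exact (setLIntegral_mono' (isOpen_dualCone hw).measurableSet fun x hx =>
    exp_neg_inner_le_transport hw hiso hunit hφ hx).trans (lintegral_transport_le_one hw hiso hφ)

/-- Equal finite integrals force the ordered integrands to agree almost everywhere; continuity
extends the resulting identity to the whole open cone. -/
theorem norm_transportMap_sq_eq_of_lintegral_eq_one (hw : Continuous w)
    (hiso : IsIsotropicFamily μ w) (hunit : ∀ ω, ‖w ω‖ = 1)
    (hφ : ∀ t, 0 < t → HasDerivAt φ (exp (-t + π * φ t ^ 2)) t)
    (heq : ∫⁻ x in dualCone w, ENNReal.ofReal (exp (-inner ℝ x (∫ ω, w ω ∂μ))) = 1)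
    {x : E} (hx : x ∈ dualCone w) :
    ‖transportMap μ w φ x‖ ^ 2 = ∫ ω, φ (inner ℝ x (w ω)) ^ 2 ∂μ := by
  have hopen := isOpen_dualCone hw
  have hφc := continuousOn_of_transport hφ
  have hmeas : AEMeasurable (fun x => ENNReal.ofReal |(transportDeriv μ w φ x).det| *
      ENNReal.ofReal (exp (-π * ‖transportMap μ w φ x‖ ^ 2)))
      (volume.restrict (dualCone w)) := by
    refine (aemeasurable_ofReal_abs_det_fderivWithin volume hopen.measurableSet fun x hx =>
      (hasFDerivAt_transportMap hw hφ hx).hasFDerivWithinAt).mul ?_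
    have : ContinuousOn (transportMap μ w φ) (dualCone w) := fun x hx =>
      (hasFDerivAt_transportMap hw hφ hx).continuousAt.continuousWithinAt
    exact ENNReal.measurable_ofReal.comp_aemeasurable
      (ContinuousOn.aemeasurable (by fun_prop) hopen.measurableSet)
  have hle : (fun x => ENNReal.ofReal (exp (-inner ℝ x (∫ ω, w ω ∂μ)))) ≤ᵐ[volume.restrict
      (dualCone w)] fun x => ENNReal.ofReal |(transportDeriv μ w φ x).det| *
        ENNReal.ofReal (exp (-π * ‖transportMap μ w φ x‖ ^ 2)) :=
    (ae_restrict_iff' hopen.measurableSet).2 <| ae_of_all _ fun x hx =>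
      exp_neg_inner_le_transport hw hiso hunit hφ hx
  have hae := ae_eq_of_ae_le_of_lintegral_le hle (by rw [heq]; exact ENNReal.one_ne_top) hmeas
    (by rw [heq]; exact lintegral_transport_le_one hw hiso hφ)
  have hae2 : (fun x => ‖transportMap μ w φ x‖ ^ 2) =ᵐ[volume.restrict (dualCone w)]
      fun x => ∫ ω, φ (inner ℝ x (w ω)) ^ 2 ∂μ := by
    filter_upwards [hae, ae_restrict_mem hopen.measurableSet] with x h hx
    obtain ⟨hpos, hle⟩ := exp_neg_inner_le_det_mul hw hiso hunit hφ hx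
    have hc := continuous_comp_inner_of_mem_dualCone hw hφc hx
    rw [← ENNReal.ofReal_mul (abs_nonneg _), abs_of_pos hpos,
      ENNReal.ofReal_eq_ofReal_iff (exp_pos _).le (by positivity)] at h
    rw [h] at hle
    have h1 := exp_le_exp.1 (le_of_mul_le_mul_left hle hpos)
    refine le_antisymm (norm_integral_smul_sq_le hw hiso hc) ?_
    nlinarith [pi_pos]
  refine Measure.eqOn_open_of_ae_eq hae2 hopen ?_ ?_ hx
  · intro y hy
    exact ((hasFDerivAt_transportMap hw hφ hy).continuousAt.norm.pow 2).continuousWithinAt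
  · intro y hy
    -- The constant vector field `1` turns the differentiation lemma into continuity of `∫ φ²`.
    have h := hasFDerivAt_integral_comp_inner (μ := μ) hw (ψ := fun t => φ t ^ 2)
      (ψ' := fun t => 2 * φ t * exp (-t + π * φ t ^ 2))
      (fun t ht => by convert! (hφ t ht).pow 2 using 1; simp) (by fun_prop)
      (v := fun _ => (1 : ℝ)) continuous_const hy
    simpa using h.continuousAt.continuousWithinAt

theorem inner_eq_zero_of_lintegral_dualCone_eq_one [μ.IsOpenPosMeasure] (hw : Continuous w)
    (hiso : IsIsotropicFamily μ w) (hunit : ∀ ω, ‖w ω‖ = 1)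
    (heq : ∫⁻ x in dualCone w, ENNReal.ofReal (exp (-inner ℝ x (∫ ω, w ω ∂μ))) = 1)
    {ω η : Ω} (hne : w ω ≠ w η) : inner ℝ (w ω) (w η) = 0 := by
  obtain ⟨φ, hφ, hφ0⟩ := exists_transport_exponential_gaussian
  by_contra hin
  have hopen := isOpen_dualCone hw
  have hφc := continuousOn_of_transport hφ
  have hT : ∀ x ∈ dualCone w, ∀ ω, inner ℝ (transportMap μ w φ x) (w ω) = φ (inner ℝ x (w ω)) :=
    fun x hx ω => (eq_inner_of_norm_integral_smul_sq_eq hw hiso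
      (continuous_comp_inner_of_mem_dualCone hw hφc hx)
      (norm_transportMap_sq_eq_of_lintegral_eq_one hw hiso hunit hφ heq hx) ω).symm
  -- Differentiating `hT` makes each `w ω` an eigenvector of the symmetric `dT` with eigenvalue
  -- `φ'(x · w ω)`; non-orthogonal ones must share their eigenvalue.
  have hdT : ∀ x ∈ dualCone w, ∀ ω v, inner ℝ (transportDeriv μ w φ x v) (w ω) =
      exp (-(inner ℝ x (w ω)) + π * φ (inner ℝ x (w ω)) ^ 2) * inner ℝ v (w ω) := by
    intro x hx ω v
    have hi : ∀ y : E, HasFDerivAt (fun y : E => inner ℝ y (w ω)) (innerSL ℝ (w ω)) y := fun y =>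
      (innerSL ℝ (w ω)).hasFDerivAt.congr_of_eventuallyEq (Eventually.of_forall fun z => by
        simp [real_inner_comm])
    have h1 := (hi _).comp x (hasFDerivAt_transportMap (μ := μ) hw hφ hx)
    have h2 := (hφ _ (hx ω)).comp_hasFDerivAt x (hi x)
    have h3 := h1.unique (h2.congr_of_eventuallyEq (by
      filter_upwards [hopen.mem_nhds hx] with y hy using hT y hy ω))
    have := DFunLike.congr_fun h3 v
    simpa [real_inner_comm] using this
  have hslope : ∀ x ∈ dualCone w, exp (-(inner ℝ x (w ω)) + π * φ (inner ℝ x (w ω)) ^ 2) =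
      exp (-(inner ℝ x (w η)) + π * φ (inner ℝ x (w η)) ^ 2) := by
    intro x hx
    have hc := continuous_comp_inner_of_mem_dualCone hw (continuousOn_deriv_of_transport hφ) hx
    have hs := isSymmetric_integral_rankOne (μ := μ) hw hc (w ω) (w η)
    change inner ℝ (transportDeriv μ w φ x (w ω)) (w η) =
      inner ℝ (w ω) (transportDeriv μ w φ x (w η)) at hs
    rw [real_inner_comm (transportDeriv μ w φ x (w η)), hdT x hx, hdT x hx,
      real_inner_comm (w ω) (w η)] at hs
    exact (mul_right_cancel₀ hin hs).symm
  obtain ⟨x₀, hx₀⟩ : (dualCone w).Nonempty := by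
    by_contra h
    rw [not_nonempty_iff_eq_empty] at h
    rw [h] at heq
    simp at heq
  -- The cone is open, so a small push along `w ω - w η` separates the two inner products.
  obtain ⟨x, hx, hxne⟩ : ∃ x ∈ dualCone w, inner ℝ x (w ω) ≠ inner ℝ x (w η) := by
    by_cases h : inner ℝ x₀ (w ω) = inner ℝ x₀ (w η)
    · have hcont : Tendsto (fun ε : ℝ => x₀ + ε • (w ω - w η)) (𝓝[>] 0) (𝓝 x₀) := by
        have : Continuous fun ε : ℝ => x₀ + ε • (w ω - w η) := by fun_prop
        have := this.tendsto 0
        simp only [zero_smul, add_zero] at this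
        exact this.mono_left nhdsWithin_le_nhds
      obtain ⟨ε, hε, hε0⟩ :=
        ((hcont.eventually (hopen.mem_nhds hx₀)).and self_mem_nhdsWithin).exists
      refine ⟨_, hε, fun h' => ?_⟩
      rw [← sub_eq_zero, ← inner_sub_right, inner_add_left, inner_smul_left, inner_sub_right, h,
        sub_self, zero_add, real_inner_self_eq_norm_sq] at h'
      have : 0 < ε * ‖w ω - w η‖ ^ 2 :=
        mul_pos hε0 (pow_pos (norm_pos_iff.2 (sub_ne_zero.2 hne)) 2)
      exact this.ne' h'
    · exact ⟨x₀, hx₀, h⟩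
  have hscale : ∀ s : ℝ, 0 < s → exp (-(s * inner ℝ x (w ω)) + π * φ (s * inner ℝ x (w ω)) ^ 2) =
      exp (-(s * inner ℝ x (w η)) + π * φ (s * inner ℝ x (w η)) ^ 2) := by
    intro s hs
    have := hslope (s • x) fun ζ => by
      rw [inner_smul_left]; exact mul_pos hs (hx ζ)
    simpa [inner_smul_left] using this
  -- Iterating with ratio `q = a / b` would make `φ'` constant along `q ^ k → 0`, against `φ → -∞`
  -- at `0`.
  have key : ∀ a b : ℝ, 0 < a → a < b → ¬ ∀ s : ℝ, 0 < s →
      exp (-(s * a) + π * φ (s * a) ^ 2) = exp (-(s * b) + π * φ (s * b) ^ 2) := by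
    intro a b ha hab h
    have hb : 0 < b := ha.trans hab
    set q := a / b
    have hq0 : 0 < q := div_pos ha hb
    have hq1 : q < 1 := (div_lt_one hb).2 hab
    have hseq : ∀ k : ℕ, exp (-(q ^ k) + π * φ (q ^ k) ^ 2) = exp (-1 + π * φ 1 ^ 2) := by
      intro k
      induction k with
      | zero => simp
      | succ k ih =>
        rw [← ih]
        have := h (q ^ k / b) (by positivity)
        rw [div_mul_cancel₀ _ hb.ne'] at this
        rw [← this]
        have e : q ^ (k + 1) = q ^ k / b * a := by
          rw [pow_succ]; simp only [q]; ring
        rw [e]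
    have hlim : Tendsto (fun k : ℕ => q ^ k) atTop (𝓝[>] 0) :=
      tendsto_nhdsWithin_iff.2 ⟨tendsto_pow_atTop_nhds_zero_of_lt_one hq0.le hq1,
        Eventually.of_forall fun k => pow_pos hq0 k⟩
    have hbot := hφ0.comp hlim
    obtain ⟨k, hk⟩ := (hbot.eventually_lt_atBot (-(|φ 1| + 1))).exists
    have h1 := exp_injective (hseq k)
    have h2 : q ^ k ≤ 1 := pow_le_one₀ hq0.le hq1.le
    simp only [Function.comp_apply] at hk
    have h3 : φ 1 ^ 2 < φ (q ^ k) ^ 2 := by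
      rw [sq_lt_sq, abs_of_neg (by linarith [abs_nonneg (φ 1)] : φ (q ^ k) < 0)]
      linarith
    nlinarith [pi_pos]
  rcases lt_or_gt_of_ne hxne with h | h
  · exact key _ _ (hx ω) h hscale
  · exact key _ _ (hx η) h fun s hs => (hscale s hs).symm

end TransportMap

/-! ### The extremal case: an orthant. -/

section Orthant

theorem lintegral_orthant_exp_neg_sum (ι : Type*) [Fintype ι] :
    ∫⁻ x in univ.pi fun _ : ι => Ioi (0 : ℝ), ENNReal.ofReal (exp (-∑ i, x i)) = 1 := by
  have h1 : IntegrableOn (fun t : ℝ => exp (-t)) (Ioi 0) := integrableOn_exp_neg_Ioi 0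
  rw [volume_pi, Measure.restrict_pi_pi]
  simp_rw [← Finset.sum_neg_distrib, exp_sum]
  rw [← ofReal_integral_eq_lintegral_ofReal (Integrable.fintype_prod fun _ => h1)
    (ae_of_all _ fun x => Finset.prod_nonneg fun i _ => (exp_pos _).le),
    integral_fintype_prod_eq_prod (fun (_ : ι) (t : ℝ) => exp (-t))]
  rw [Finset.prod_const, integral_exp_neg_Ioi, neg_zero, exp_zero, one_pow,
    ENNReal.ofReal_one]

variable {ι H : Type*} [Fintype ι] [NormedAddCommGroup H] [InnerProductSpace ℝ H]
  [FiniteDimensional ℝ H] [MeasurableSpace H] [BorelSpace H]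

theorem lintegral_dualCone_orthonormalBasis (b : OrthonormalBasis ι ℝ H) :
    ∫⁻ x in dualCone b, ENNReal.ofReal (exp (-inner ℝ x (∑ i, b i))) = 1 := by
  have hmp := (PiLp.volume_preserving_ofLp ι).comp b.measurePreserving_repr
  have hset : MeasurableSet (univ.pi fun _ : ι => Ioi (0 : ℝ)) :=
    MeasurableSet.univ_pi fun _ => measurableSet_Ioi
  have h := hmp.setLIntegral_comp_preimage hset
    (f := fun x => ENNReal.ofReal (exp (-∑ i, x i))) (by fun_prop)
  rw [lintegral_orthant_exp_neg_sum] at h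
  rw [← h]
  have e : dualCone b = WithLp.ofLp ∘ b.repr ⁻¹' (univ.pi fun _ : ι => Ioi (0 : ℝ)) := by
    ext x
    simp [dualCone, OrthonormalBasis.repr_apply_apply, real_inner_comm]
  rw [← e]
  refine lintegral_congr fun x => ?_
  simp [inner_sum, OrthonormalBasis.repr_apply_apply, real_inner_comm]

end Orthant

/-! ### Lifting to one more dimension; slicing the cone. -/

section Lift

variable {E : Type*} [NormedAddCommGroup E] [InnerProductSpace ℝ E] [FiniteDimensional ℝ E]

open Module (finrank)

/-- The lift of a unit vector `u` of a `d`-dimensional space `E` to the unit vector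
`(d + 1) ^ (-1/2) (-√d u, 1)` of `E × ℝ`. -/
def liftVec (u : E) : WithLp 2 (E × ℝ) :=
  WithLp.toLp 2 (-(√(finrank ℝ E / (finrank ℝ E + 1)) • u), 1 / √(finrank ℝ E + 1))

theorem continuous_liftVec : Continuous (liftVec : E → WithLp 2 (E × ℝ)) := by
  unfold liftVec
  fun_prop

theorem inner_liftVec (x : WithLp 2 (E × ℝ)) (u : E) :
    inner ℝ x (liftVec u) = 1 / √(finrank ℝ E + 1) * x.snd -
      √(finrank ℝ E / (finrank ℝ E + 1)) * inner ℝ x.fst u := by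
  rw [WithLp.prod_inner_apply]
  simp [liftVec, inner_neg_right, inner_smul_right]
  ring

/-- Lifts of `u` and `v` are orthogonal exactly when `u · v = -1 / d`, the value for vertices of a
regular simplex. -/
theorem inner_liftVec_liftVec (u v : E) :
    inner ℝ (liftVec u) (liftVec v) =
      (finrank ℝ E * inner ℝ u v + 1) / (finrank ℝ E + 1 : ℝ) := by
  have h1 : √(finrank ℝ E / (finrank ℝ E + 1) : ℝ) ^ 2 = finrank ℝ E / (finrank ℝ E + 1) :=
    sq_sqrt (by positivity)
  have h2 : (1 / √(finrank ℝ E + 1 : ℝ)) ^ 2 = 1 / (finrank ℝ E + 1) := by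
    rw [div_pow, sq_sqrt (by positivity), one_pow]
  rw [inner_liftVec]
  simp only [liftVec, inner_neg_left, inner_smul_left, WithLp.toLp_fst, WithLp.toLp_snd,
    conj_trivial]
  calc _ = (1 / √(finrank ℝ E + 1 : ℝ)) ^ 2 +
        √(finrank ℝ E / (finrank ℝ E + 1) : ℝ) ^ 2 * inner ℝ u v := by ring
    _ = _ := by rw [h1, h2]; field_simp; ring

theorem norm_liftVec {u : E} (hu : ‖u‖ = 1) : ‖liftVec u‖ = 1 := by
  have h := inner_liftVec_liftVec u u
  rw [real_inner_self_eq_norm_sq, real_inner_self_eq_norm_sq, hu, one_pow, mul_one,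
    div_self (by positivity)] at h
  exact (pow_eq_one_iff_of_nonneg (norm_nonneg _) two_ne_zero).1 h

variable [MeasurableSpace E] [BorelSpace E]

/-- A Gamma integral in the height `r`; the claimed volume bound arises as its reciprocal. -/
theorem lintegral_exp_neg_mul_pow (d : ℕ) :
    ∫⁻ r in Ioi (0 : ℝ), ENNReal.ofReal (exp (-(√(d + 1) * r))) * ENNReal.ofReal ((r / √d) ^ d) =
      (ENNReal.ofReal ((d : ℝ) ^ ((d : ℝ) / 2) * ((d : ℝ) + 1) ^ (((d : ℝ) + 1) / 2) /
        (Nat.factorial d : ℝ)))⁻¹ := by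
  have hs : 0 < √(d + 1 : ℝ) := sqrt_pos.2 (by positivity)
  have hG := integral_rpow_mul_exp_neg_mul_Ioi (a := d + 1) (by positivity) hs
  rw [Real.Gamma_nat_eq_factorial] at hG
  have hd : (0 : ℝ) < √d ^ d := by
    rcases Nat.eq_zero_or_pos d with h | h
    · simp [h]
    · exact pow_pos (sqrt_pos.2 (by exact_mod_cast h)) d
  have hval : ∫ r in Ioi (0 : ℝ), exp (-(√(d + 1) * r)) * (r / √d) ^ d =
      ((d : ℝ) ^ ((d : ℝ) / 2) * ((d : ℝ) + 1) ^ (((d : ℝ) + 1) / 2) /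
        (Nat.factorial d : ℝ))⁻¹ := by
    calc _ = ∫ r in Ioi (0 : ℝ), (√d ^ d)⁻¹ * (r ^ ((d : ℝ) + 1 - 1) * exp (-(√(d + 1) * r))) := by
          refine setIntegral_congr_fun measurableSet_Ioi fun r hr => ?_
          simp only [add_sub_cancel_right, rpow_natCast, div_pow]
          ring
      _ = _ := by
          rw [integral_const_mul, hG]
          have e1 : √(d : ℝ) ^ d = (d : ℝ) ^ ((d : ℝ) / 2) := by
            rw [sqrt_eq_rpow, ← rpow_natCast, ← rpow_mul (by positivity)]
            ring_nf
          have e2 : (1 / √(d + 1 : ℝ)) ^ ((d : ℝ) + 1) =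
              (((d : ℝ) + 1) ^ (((d : ℝ) + 1) / 2))⁻¹ := by
            rw [one_div, inv_rpow (sqrt_nonneg _), sqrt_eq_rpow, ← rpow_mul (by positivity)]
            ring_nf
          rw [e1, e2]
          simp only [div_eq_mul_inv, mul_inv, inv_inv]
          ring
  have hpos : 0 < ((d : ℝ) ^ ((d : ℝ) / 2) * ((d : ℝ) + 1) ^ (((d : ℝ) + 1) / 2) /
        (Nat.factorial d : ℝ)) := by
    have : (0 : ℝ) < (d : ℝ) ^ ((d : ℝ) / 2) := by
      rcases Nat.eq_zero_or_pos d with h | h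
      · simp [h]
      · exact rpow_pos_of_pos (by exact_mod_cast h) _
    positivity
  have hint : IntegrableOn (fun r : ℝ => exp (-(√(d + 1) * r)) * (r / √d) ^ d) (Ioi 0) := by
    by_contra hn
    rw [integral_undef hn] at hval
    exact (inv_pos.2 hpos).ne hval
  rw [← ENNReal.ofReal_inv_of_pos hpos, ← hval, ofReal_integral_eq_lintegral_ofReal hint]
  · refine lintegral_congr fun r => ?_
    rw [ENNReal.ofReal_mul (exp_pos _).le]
  · refine (ae_restrict_iff' measurableSet_Ioi).2 (ae_of_all _ fun r hr => ?_)
    have : (0 : ℝ) ≤ r := le_of_lt hr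
    dsimp only [Pi.zero_apply]
    positivity

theorem volume_setOf_inner_lt {Ω : Type*} (u : Ω → E) {t : ℝ} (ht : 0 < t) :
    volume {y : E | ∀ ω, inner ℝ y (u ω) < t} =
      ENNReal.ofReal (t ^ finrank ℝ E) * volume {y : E | ∀ ω, inner ℝ y (u ω) < 1} := by
  have e : {y : E | ∀ ω, inner ℝ y (u ω) < t} = t • {y : E | ∀ ω, inner ℝ y (u ω) < 1} := by
    ext y
    rw [mem_smul_set_iff_inv_smul_mem₀ ht.ne']
    simp [inner_smul_left, inv_mul_lt_iff₀ ht]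
  rw [e, Measure.addHaar_smul_of_nonneg _ ht.le]

/-- Fubini in the height: slices at `r > 0` are dilates of one body by `r / √d`, and `hcen` makes
the slices at `r ≤ 0` empty. -/
theorem lintegral_dualCone_liftVec {Ω : Type*} [TopologicalSpace Ω] [CompactSpace Ω]
    (hd : 0 < finrank ℝ E) {u : Ω → E} (hu : Continuous u)
    (hcen : ∀ y, ∃ ω, 0 ≤ inner ℝ y (u ω)) :
    ∫⁻ x in dualCone fun ω => liftVec (u ω),
        ENNReal.ofReal (exp (-(√(finrank ℝ E + 1) * x.snd))) =
      volume {y : E | ∀ ω, inner ℝ y (u ω) < 1} *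
      (ENNReal.ofReal ((finrank ℝ E : ℝ) ^ ((finrank ℝ E : ℝ) / 2) *
        ((finrank ℝ E : ℝ) + 1) ^ (((finrank ℝ E : ℝ) + 1) / 2) /
        (Nat.factorial (finrank ℝ E) : ℝ)))⁻¹ := by
  set d := finrank ℝ E with hdef
  have hd' : (0 : ℝ) < d := by exact_mod_cast hd
  have hopen : IsOpen (dualCone fun ω => liftVec (u ω)) :=
    isOpen_dualCone (continuous_liftVec.comp hu)
  have hmp := WithLp.volume_preserving_toLp E ℝ
  rw [← hmp.setLIntegral_comp_preimage hopen.measurableSet (by fun_prop)]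
  have hpre : MeasurableSet (WithLp.toLp 2 ⁻¹' (dualCone fun ω => liftVec (u ω)) :
      Set (E × ℝ)) := hmp.measurable hopen.measurableSet
  rw [← lintegral_indicator hpre, Measure.volume_eq_prod, lintegral_prod_symm' _
    (Measurable.indicator (by fun_prop) hpre), ← lintegral_exp_neg_mul_pow d,
    ← lintegral_const_mul _ (by fun_prop), ← lintegral_indicator measurableSet_Ioi]
  refine lintegral_congr fun r => ?_
  have hmem : ∀ y : E, ((y, r) ∈ WithLp.toLp 2 ⁻¹' (dualCone fun ω => liftVec (u ω))) ↔
      ∀ ω, inner ℝ y (u ω) < r / √d := by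
    intro y
    simp only [mem_preimage, dualCone, mem_ofPred_eq, inner_liftVec, WithLp.toLp_fst,
      WithLp.toLp_snd]
    refine forall_congr' fun ω => ?_
    rw [← hdef, sqrt_div hd'.le, sub_pos, lt_div_iff₀ (sqrt_pos.2 hd')]
    have hs : 0 < √(d + 1 : ℝ) := sqrt_pos.2 (by positivity)
    rw [one_div_mul_eq_div, div_mul_eq_mul_div, div_lt_div_iff_of_pos_right hs, mul_comm]
  by_cases hr : 0 < r
  · rw [indicator_of_mem (show r ∈ Ioi 0 from hr)]
    have e : ∀ y : E, (WithLp.toLp 2 ⁻¹' (dualCone fun ω => liftVec (u ω))).indicator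
        (fun a : E × ℝ => ENNReal.ofReal (exp (-(√(d + 1) * (WithLp.toLp 2 a).snd)))) (y, r) =
        {y : E | ∀ ω, inner ℝ y (u ω) < r / √d}.indicator
          (fun _ => ENNReal.ofReal (exp (-(√(d + 1) * r)))) y := by
      intro y
      by_cases h : ∀ ω, inner ℝ y (u ω) < r / √d
      · rw [indicator_of_mem ((hmem y).2 h), indicator_of_mem (by exact h),
          WithLp.toLp_snd]
      · rw [indicator_of_notMem (fun h' => h ((hmem y).1 h')), indicator_of_notMem (by exact h)]
    have hm : MeasurableSet {y : E | ∀ ω, inner ℝ y (u ω) < r / √d} := by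
      have : {y : E | ∀ ω, inner ℝ y (u ω) < r / √d} =
          (fun y : E => (y, r)) ⁻¹' (WithLp.toLp 2 ⁻¹' (dualCone fun ω => liftVec (u ω))) := by
        ext y
        exact (hmem y).symm
      rw [this]
      exact measurable_prodMk_right hpre
    simp_rw [e]
    rw [lintegral_indicator hm, lintegral_const, Measure.restrict_apply_univ,
      volume_setOf_inner_lt u (div_pos hr (sqrt_pos.2 hd'))]
    ring
  · rw [indicator_of_notMem (show r ∉ Ioi 0 from hr)]
    refine (lintegral_congr fun y => ?_).trans lintegral_zero
    refine indicator_of_notMem (fun h => ?_) _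
    obtain ⟨ω, hω⟩ := hcen y
    have h1 := (hmem y).1 h ω
    have h2 : r / √d ≤ 0 := div_nonpos_of_nonpos_of_nonneg (not_lt.1 hr) (sqrt_nonneg _)
    linarith

end Lift

/-! ### Strict versus non-strict inequalities in the polar. -/

section PolarVolume

variable {n : ℕ}

theorem convex_polarBody (K : Set (EuclideanSpace ℝ (Fin n))) : Convex ℝ (polarBody K) := by
  have h : polarBody K = ⋂ v ∈ K, {x | inner ℝ v x ≤ 1} := by
    ext x
    simp [polarBody, real_inner_comm]
  rw [h]
  exact convex_iInter₂ fun v _ => convex_halfSpace_le (innerSL ℝ v).toLinearMap.isLinear 1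

/-- The two sets differ only within the frontier of a convex set, which is null. -/
theorem volume_polarBody_eq_volume_setOf_inner_lt {Ω : Type*} (u : Ω → EuclideanSpace ℝ (Fin n))
    (hu : ∀ ω, ‖u ω‖ = 1) :
    volume (polarBody (range u)) =
      volume {y : EuclideanSpace ℝ (Fin n) | ∀ ω, inner ℝ y (u ω) < 1} := by
  set P := polarBody (range u)
  have hsub : interior P ⊆ {y | ∀ ω, inner ℝ y (u ω) < 1} := by
    intro y hy ω
    have hcont : Tendsto (fun t : ℝ => y + t • u ω) (𝓝[>] 0) (𝓝 y) := by
      have : Continuous fun t : ℝ => y + t • u ω := by fun_prop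
      have := this.tendsto 0
      simp only [zero_smul, add_zero] at this
      exact this.mono_left nhdsWithin_le_nhds
    obtain ⟨t, ht, ht0⟩ := ((hcont.eventually (isOpen_interior.mem_nhds hy)).and
      self_mem_nhdsWithin).exists
    have h := interior_subset ht (u ω) (mem_range_self ω)
    rw [inner_add_left, inner_smul_left, real_inner_self_eq_norm_sq, hu] at h
    have h0 : 0 < t := ht0
    simp only [conj_trivial, one_pow, mul_one] at h
    linarith
  have hsub' : {y : EuclideanSpace ℝ (Fin n) | ∀ ω, inner ℝ y (u ω) < 1} ⊆ P := by
    rintro y hy _ ⟨ω, rfl⟩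
    exact (hy ω).le
  refine le_antisymm ?_ (measure_mono hsub')
  calc volume P ≤ volume (interior P ∪ frontier P) := by
        refine measure_mono ?_
        rw [← closure_eq_interior_union_frontier]
        exact subset_closure
    _ ≤ volume (interior P) + volume (frontier P) := measure_union_le _ _
    _ = volume (interior P) := by rw [(convex_polarBody _).addHaar_frontier volume, add_zero]
    _ ≤ _ := measure_mono hsub

end PolarVolume

/-! ### The lifted measure of an isotropic centred `Z`. -/

namespace SphereMeasure

open scoped NNReal

variable {n : ℕ} {Z : Measure (Metric.sphere (0 : EuclideanSpace ℝ (Fin n)) 1)}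
  [IsFiniteMeasure Z]

theorem integrable_of_continuous {F : Type*} [NormedAddCommGroup F] [NormedSpace ℝ F]
    {f : Metric.sphere (0 : EuclideanSpace ℝ (Fin n)) 1 → F} (hf : Continuous f) :
    Integrable f Z :=
  integrable_of_continuous_compactSpace hf

/-- Trace of the isotropy identity over an orthonormal basis. -/
theorem IsIsotropic.measureReal_univ (hiso : IsIsotropic Z) : Z.real univ = n := by
  have h1 : ∫ _, (1 : ℝ) ∂Z = ∑ i : Fin n,
      ∫ u, |inner ℝ (EuclideanSpace.basisFun (Fin n) ℝ i) (u : EuclideanSpace ℝ (Fin n))| ^ 2 ∂Z := by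
    rw [← integral_finsetSum _ fun i _ => integrable_of_continuous (by fun_prop)]
    refine integral_congr_ae (ae_of_all _ fun u => ?_)
    have h := (EuclideanSpace.basisFun (Fin n) ℝ).sum_sq_norm_inner_right
      (u : EuclideanSpace ℝ (Fin n))
    rw [norm_eq_of_mem_sphere, one_pow] at h
    exact h.symm
  simp_rw [← hiso _, OrthonormalBasis.norm_eq_one] at h1
  simpa using h1

theorem integral_coe_eq_zero (hn : 1 ≤ n) (hiso : IsIsotropic Z) (hcen : centroid Z = 0) :
    ∫ u, (u : EuclideanSpace ℝ (Fin n)) ∂Z = 0 := by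
  rw [centroid, smul_eq_zero, hiso.measureReal_univ] at hcen
  refine hcen.resolve_left (inv_ne_zero ?_)
  exact_mod_cast (by omega : n ≠ 0)

theorem integral_inner_coe_eq_zero (hn : 1 ≤ n) (hiso : IsIsotropic Z) (hcen : centroid Z = 0)
    (y : EuclideanSpace ℝ (Fin n)) :
    ∫ u, inner ℝ y (u : EuclideanSpace ℝ (Fin n)) ∂Z = 0 := by
  rw [integral_inner (integrable_of_continuous continuous_subtype_val),
    integral_coe_eq_zero hn hiso hcen, inner_zero_right]

theorem integral_inner_coe_sq (hiso : IsIsotropic Z) (y : EuclideanSpace ℝ (Fin n)) :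
    ∫ u, inner ℝ y (u : EuclideanSpace ℝ (Fin n)) ^ 2 ∂Z = ‖y‖ ^ 2 := by
  simpa using (hiso y).symm

/-- The restriction of `((n + 1) / n) Z` to the support of `Z`. -/
def supportMeasure (Z : Measure (Metric.sphere (0 : EuclideanSpace ℝ (Fin n)) 1)) :
    Measure Z.support :=
  (((n : ℝ≥0) + 1) / n) • Z.comap Subtype.val

theorem integral_supportMeasure {F : Type*} [NormedAddCommGroup F] [NormedSpace ℝ F]
    (f : Metric.sphere (0 : EuclideanSpace ℝ (Fin n)) 1 → F) :
    ∫ ω : Z.support, f ω ∂supportMeasure Z = (((n : ℝ) + 1) / n) • ∫ u, f u ∂Z := by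
  rw [supportMeasure, integral_smul_nnreal_measure,
    integral_subtype_comap Measure.isClosed_support.measurableSet,
    Measure.restrict_eq_self_of_ae_mem (s := Z.support) (Measure.support_mem_ae (μ := Z)), NNReal.smul_def]
  simp

instance : IsFiniteMeasure (Z.comap (Subtype.val : Z.support → _)) :=
  ⟨by
    rw [MeasurableEmbedding.comap_apply
      (MeasurableEmbedding.subtype_coe Measure.isClosed_support.measurableSet)]
    exact measure_lt_top _ _⟩

instance : IsFiniteMeasure (supportMeasure Z) := by
  unfold supportMeasure
  infer_instance

/-- Full support is what turns almost-everywhere equality into equality at every lifted vector. -/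
theorem isOpenPosMeasure_supportMeasure (hn : 1 ≤ n) :
    (supportMeasure Z).IsOpenPosMeasure := by
  refine ⟨fun U hU ⟨ω, hω⟩ h0 => ?_⟩
  have hemb := MeasurableEmbedding.subtype_coe
    (Measure.isClosed_support (μ := Z)).measurableSet
  obtain ⟨V, hV, rfl⟩ := isOpen_induced_iff.1 hU
  have hpos : 0 < Z V := (Measure.mem_support_iff_forall _).1 ω.2 V (hV.mem_nhds hω)
  have hc : (((n : ℝ≥0) + 1) / n) ≠ 0 := by
    have : (n : ℝ≥0) ≠ 0 := by exact_mod_cast (by omega : n ≠ 0)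
    positivity
  rw [supportMeasure, Measure.smul_apply, hemb.comap_apply, Subtype.image_preimage_coe,
    ENNReal.smul_def, smul_eq_mul, mul_eq_zero] at h0
  have h1 := h0.resolve_left (by exact_mod_cast hc)
  refine hpos.ne' (le_antisymm ?_ zero_le)
  calc Z V ≤ Z (Z.support ∩ V) + Z Z.supportᶜ := by
        refine (measure_mono fun x hx => ?_).trans (measure_union_le _ _)
        by_cases h : x ∈ Z.support
        · exact Or.inl ⟨h, hx⟩
        · exact Or.inr h
    _ = 0 := by rw [h1, Measure.measure_compl_support, add_zero]

/-- The lifted family of unit vectors, indexed by the support of `Z`. -/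
def liftedSupport (Z : Measure (Metric.sphere (0 : EuclideanSpace ℝ (Fin n)) 1)) (ω : Z.support) :
    WithLp 2 (EuclideanSpace ℝ (Fin n) × ℝ) :=
  liftVec (ω : EuclideanSpace ℝ (Fin n))

theorem continuous_liftedSupport : Continuous (liftedSupport Z) :=
  continuous_liftVec.comp (continuous_subtype_val.comp continuous_subtype_val)

theorem norm_liftedSupport (ω : Z.support) : ‖liftedSupport Z ω‖ = 1 :=
  norm_liftVec (norm_eq_of_mem_sphere _)

instance : CompactSpace Z.support :=
  isCompact_iff_compactSpace.1 Measure.isClosed_support.isCompact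

/-- The cross term vanishes because the centroid is `0`; the factor `(n + 1) / n` and total mass `n`
make both squared coefficients equal to `1`. -/
theorem isIsotropicFamily_liftedSupport (hn : 1 ≤ n) (hiso : IsIsotropic Z)
    (hcen : centroid Z = 0) : IsIsotropicFamily (supportMeasure Z) (liftedSupport Z) := by
  intro x
  have hn0 : (0 : ℝ) < n := by exact_mod_cast hn
  simp only [liftedSupport, inner_liftVec, finrank_euclideanSpace_fin]
  rw [integral_supportMeasure (fun u : Metric.sphere (0 : EuclideanSpace ℝ (Fin n)) 1 => (1 / √((n : ℝ) + 1) * x.snd -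
    √(n / ((n : ℝ) + 1)) * inner ℝ x.fst (u : EuclideanSpace ℝ (Fin n))) ^ 2)]
  have h1 : √(n / (n + 1) : ℝ) ^ 2 = n / (n + 1) := sq_sqrt (by positivity)
  have h2 : (1 / √(n + 1 : ℝ)) ^ 2 = 1 / (n + 1) := by
    rw [div_pow, sq_sqrt (by positivity), one_pow]
  set a := √(n / (n + 1) : ℝ)
  set b := 1 / √(n + 1 : ℝ)
  have e : ∀ u : Metric.sphere (0 : EuclideanSpace ℝ (Fin n)) 1,
      (b * x.snd - a * inner ℝ x.fst (u : EuclideanSpace ℝ (Fin n))) ^ 2 =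
      (b ^ 2 * x.snd ^ 2 - 2 * a * b * x.snd * inner ℝ x.fst (u : EuclideanSpace ℝ (Fin n))) +
        a ^ 2 * inner ℝ x.fst (u : EuclideanSpace ℝ (Fin n)) ^ 2 := fun u => by ring
  simp_rw [e]
  rw [integral_add, integral_sub, integral_const_mul, integral_const_mul,
    integral_const_mul,    integral_inner_coe_eq_zero hn hiso hcen, integral_inner_coe_sq hiso, integral_const,
    hiso.measureReal_univ, h1, h2, WithLp.prod_norm_sq_eq_of_L2]
  · simp only [smul_eq_mul, norm_eq_abs, sq_abs]
    field_simp
    ring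
  all_goals exact integrable_of_continuous (by fun_prop)

theorem inner_integral_liftedSupport (hn : 1 ≤ n) (hiso : IsIsotropic Z) (hcen : centroid Z = 0)
    (x : WithLp 2 (EuclideanSpace ℝ (Fin n) × ℝ)) :
    inner ℝ x (∫ ω, liftedSupport Z ω ∂supportMeasure Z) = √(n + 1) * x.snd := by
  have hn0 : (0 : ℝ) < n := by exact_mod_cast hn
  rw [← integral_inner (integrable_of_continuous_compactSpace continuous_liftedSupport)]
  simp only [liftedSupport, inner_liftVec, finrank_euclideanSpace_fin]
  rw [integral_supportMeasure (fun u : Metric.sphere (0 : EuclideanSpace ℝ (Fin n)) 1 => 1 / √((n : ℝ) + 1) * x.snd -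
    √(n / ((n : ℝ) + 1)) * inner ℝ x.fst (u : EuclideanSpace ℝ (Fin n))), integral_sub,
    integral_const_mul, integral_const_mul, integral_inner_coe_eq_zero hn hiso hcen, integral_const,
    hiso.measureReal_univ]
  · have h : √((n : ℝ) + 1) ^ 2 = n + 1 := sq_sqrt (by positivity)
    have h0 : 0 < √((n : ℝ) + 1) := sqrt_pos.2 (by positivity)
    simp only [smul_eq_mul]
    field_simp
    rw [h]
    ring
  all_goals exact integrable_of_continuous (by fun_prop)

/-- Otherwise a function of integral zero would be negative almost everywhere, although `Z` has mass
`n > 0`. -/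
theorem exists_mem_support_inner_nonneg (hn : 1 ≤ n) (hiso : IsIsotropic Z)
    (hcen : centroid Z = 0) (y : EuclideanSpace ℝ (Fin n)) :
    ∃ ω : Z.support, 0 ≤ inner ℝ y (ω : EuclideanSpace ℝ (Fin n)) := by
  by_contra! h
  have h0 := integral_inner_coe_eq_zero hn hiso hcen y
  have hneg : ∀ᵐ u : Metric.sphere (0 : EuclideanSpace ℝ (Fin n)) 1 ∂Z, inner ℝ y (u : EuclideanSpace ℝ (Fin n)) < 0 := by
    filter_upwards [Measure.support_mem_ae (μ := Z)] with u hu using h ⟨u, hu⟩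
  have h1 : ∫ u, -inner ℝ y (u : EuclideanSpace ℝ (Fin n)) ∂Z = 0 := by
    rw [integral_neg, h0, neg_zero]
  rw [integral_eq_zero_iff_of_nonneg_ae (hneg.mono fun u hu => (neg_pos.2 hu).le)
    (integrable_of_continuous (by fun_prop))] at h1
  have hfalse : ∀ᵐ u ∂Z, False := by
    filter_upwards [hneg, h1] with u hu hu0
    simp only [Pi.zero_apply] at hu0
    linarith
  rw [eventually_false_iff_eq_bot, ae_eq_bot] at hfalse
  have hm := hiso.measureReal_univ
  rw [hfalse] at hm
  have : (n : ℝ) = 0 := by simpa using hm.symm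
  have : n = 0 := by exact_mod_cast this
  omega

theorem lintegral_dualCone_liftedSupport (hn : 1 ≤ n) (hiso : IsIsotropic Z)
    (hcen : centroid Z = 0) :
    ∫⁻ x in dualCone (liftedSupport Z), ENNReal.ofReal
        (exp (-inner ℝ x (∫ ω, liftedSupport Z ω ∂supportMeasure Z))) =
      volume (polarBody (hullSupport Z)) *
      (ENNReal.ofReal ((n : ℝ) ^ ((n : ℝ) / 2) * ((n : ℝ) + 1) ^ (((n : ℝ) + 1) / 2) /
        (Nat.factorial n : ℝ)))⁻¹ := by
  have hrange : (fun u : Metric.sphere (0 : EuclideanSpace ℝ (Fin n)) 1 =>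
      (u : EuclideanSpace ℝ (Fin n))) '' Z.support =
      range fun ω : Z.support => (ω : EuclideanSpace ℝ (Fin n)) := by
    rw [image_eq_range]
  rw [hullSupport, polarBody_convexHull, hrange, image_id',
    volume_polarBody_eq_volume_setOf_inner_lt _ fun ω => norm_eq_of_mem_sphere _]
  simp_rw [inner_integral_liftedSupport hn hiso hcen]
  have h := lintegral_dualCone_liftVec (E := EuclideanSpace ℝ (Fin n))
    (by rw [finrank_euclideanSpace_fin]; omega)
    (u := fun ω : Z.support => (ω : EuclideanSpace ℝ (Fin n)))
    (continuous_subtype_val.comp continuous_subtype_val)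
    (exists_mem_support_inner_nonneg hn hiso hcen)
  simp only [finrank_euclideanSpace_fin] at h
  exact h

end SphereMeasure

/-! ### Recovering the support from its hull; regular simplices. -/

section SphereHull

/-- Points of the sphere are extreme in the ball, hence in the hull, and extreme points of a hull
lie in the generating set. -/
theorem subset_of_convexHull_eq_of_subset_sphere {E : Type*} [NormedAddCommGroup E]
    [InnerProductSpace ℝ E] {S T : Set E} (hS : S ⊆ Metric.sphere 0 1)
    (hT : T ⊆ Metric.sphere 0 1) (h : convexHull ℝ S = convexHull ℝ T) : S ⊆ T := by
  intro x hx
  have hx1 := StrictConvexSpace.sphere_subset_extremePoints_closedBall (0 : E) one_ne_zero (hS hx)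
  have hsub : convexHull ℝ T ⊆ Metric.closedBall 0 1 :=
    convexHull_min (hT.trans Metric.sphere_subset_closedBall) (convex_closedBall 0 1)
  refine extremePoints_convexHull_subset (𝕜 := ℝ) (inter_extremePoints_subset_extremePoints_of_subset
    hsub ⟨?_, hx1⟩)
  rw [← h]
  exact subset_convexHull ℝ S hx

end SphereHull

section RegularSimplex

variable {n : ℕ}

theorem finrank_prod_real :
    Module.finrank ℝ (WithLp 2 (EuclideanSpace ℝ (Fin n) × ℝ)) = n + 1 := by
  rw [(WithLp.linearEquiv 2 ℝ (EuclideanSpace ℝ (Fin n) × ℝ)).finrank_eq]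
  simp

theorem liftVec_injective (hn : 1 ≤ n) :
    Function.Injective (liftVec : EuclideanSpace ℝ (Fin n) → _) := by
  intro u v h
  have hn0 : (0 : ℝ) < n := by exact_mod_cast hn
  have h1 := congrArg WithLp.fst h
  simp only [liftVec, WithLp.toLp_fst, neg_inj, finrank_euclideanSpace_fin] at h1
  exact smul_right_injective _ (sqrt_pos.2 (by positivity)).ne' h1

theorem exists_orthonormalBasis_eq_liftVec {p : Fin (n + 1) → EuclideanSpace ℝ (Fin n)}
    (hp : Orthonormal ℝ fun i => liftVec (p i)) :
    ∃ b : OrthonormalBasis (Fin (n + 1)) ℝ (WithLp 2 (EuclideanSpace ℝ (Fin n) × ℝ)),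
      ∀ i, b i = liftVec (p i) := by
  have hcard : Fintype.card (Fin (n + 1)) =
      Module.finrank ℝ (WithLp 2 (EuclideanSpace ℝ (Fin n) × ℝ)) := by
    rw [finrank_prod_real, Fintype.card_fin]
  exact ⟨(basisOfOrthonormalOfCardEqFinrank hp hcard).toOrthonormalBasis (by simpa using hp),
    fun i => by simp⟩

/-- The last coordinate of a lift is constant, so an affine relation among the `p i` is a linear one
among their lifts. -/
theorem affineIndependent_of_orthonormal_liftVec {p : Fin (n + 1) → EuclideanSpace ℝ (Fin n)}
    (hp : Orthonormal ℝ fun i => liftVec (p i)) : AffineIndependent ℝ p := by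
  rw [affineIndependent_iff]
  intro s w hw hwp
  refine linearIndependent_iff'.1 hp.linearIndependent s w ?_
  have h : ∀ x, inner ℝ x (∑ i ∈ s, w i • liftVec (p i)) = 0 := by
    intro x
    simp only [inner_sum, inner_smul_right, inner_liftVec, mul_sub]
    rw [Finset.sum_sub_distrib, ← Finset.sum_mul, hw, zero_mul, zero_sub, neg_eq_zero]
    have : inner ℝ x.fst (∑ i ∈ s, w i • p i) = 0 := by rw [hwp, inner_zero_right]
    simp only [inner_sum, inner_smul_right] at this
    simp_rw [mul_left_comm (w _)]
    rw [← Finset.mul_sum, this, mul_zero]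
  exact inner_self_eq_zero.1 (h _)

/-- The orthogonal map permuting the lifted basis fixes the vertical vector `e`, a multiple of the
sum of the basis; so it preserves the horizontal copy of `ℝⁿ` and acts there as the required
isometry. -/
theorem exists_isometryEquiv_of_orthonormal_liftVec (hn : 1 ≤ n)
    {p : Fin (n + 1) → EuclideanSpace ℝ (Fin n)} (hp : Orthonormal ℝ fun i => liftVec (p i))
    (σ : Equiv.Perm (Fin (n + 1))) :
    ∃ g : EuclideanSpace ℝ (Fin n) ≃ᵢ EuclideanSpace ℝ (Fin n), ∀ i, p (σ i) = g (p i) := by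
  have hn0 : (0 : ℝ) < n := by exact_mod_cast hn
  obtain ⟨b, hb⟩ := exists_orthonormalBasis_eq_liftVec hp
  let L := b.equiv b σ
  have hL : ∀ i, L (b i) = b (σ i) := fun i => by simp [L]
  let e : WithLp 2 (EuclideanSpace ℝ (Fin n) × ℝ) := WithLp.toLp 2 (0, 1)
  have he : ∀ x, inner ℝ x e = x.snd := fun x => by
    rw [WithLp.prod_inner_apply]; simp [e]
  have heb : e = ∑ i, (1 / √((n : ℝ) + 1)) • b i := by
    conv_lhs => rw [← b.sum_repr' e]
    refine Finset.sum_congr rfl fun i _ => ?_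
    rw [he, hb]
    simp [liftVec]
  have hLe : L e = e := by
    conv_lhs => rw [heb]
    simp only [map_sum, map_smul, hL]
    rw [heb, ← Equiv.sum_comp σ fun i => (1 / √((n : ℝ) + 1)) • b i]
  let f : EuclideanSpace ℝ (Fin n) →ₗ[ℝ] WithLp 2 (EuclideanSpace ℝ (Fin n) × ℝ) :=
    L.toLinearEquiv.toLinearMap ∘ₗ
      (WithLp.linearEquiv 2 ℝ (EuclideanSpace ℝ (Fin n) × ℝ)).symm.toLinearMap ∘ₗ
      LinearMap.inl ℝ (EuclideanSpace ℝ (Fin n)) ℝ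
  have hsnd : ∀ x, (f x).snd = 0 := by
    intro x
    rw [← he, ← hLe]
    change inner ℝ (L (WithLp.toLp 2 (x, 0))) (L e) = 0
    rw [L.inner_map_map, he, WithLp.toLp_snd]
  let A : EuclideanSpace ℝ (Fin n) →ₗᵢ[ℝ] EuclideanSpace ℝ (Fin n) :=
    { toFun := fun x => (f x).fst
      map_add' := fun x y => by rw [map_add]; rfl
      map_smul' := fun c x => by rw [map_smul]; rfl
      norm_map' := fun x => by
        have h1 := WithLp.prod_norm_sq_eq_of_L2 (f x)
        have h2 : ‖f x‖ = ‖WithLp.toLp 2 (x, (0 : ℝ))‖ := L.norm_map _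
        rw [hsnd, h2, WithLp.prod_norm_sq_eq_of_L2] at h1
        simp only [norm_zero, WithLp.toLp_fst, WithLp.toLp_snd, add_left_inj] at h1
        exact ((sq_eq_sq₀ (norm_nonneg _) (norm_nonneg _)).1 h1).symm }
  refine ⟨(A.toLinearIsometryEquiv rfl).toIsometryEquiv, fun i => ?_⟩
  change p (σ i) = (f (p i)).fst
  have hs : 0 < √((n : ℝ) / (n + 1)) := sqrt_pos.2 (by positivity)
  have hdec : ∀ j, WithLp.toLp 2 (p j, (0 : ℝ)) =
      (√((n : ℝ) / (n + 1)))⁻¹ • ((1 / √((n : ℝ) + 1)) • e - b j) := by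
    intro j
    rw [hb, eq_inv_smul_iff₀ hs.ne']
    simp only [e, liftVec, finrank_euclideanSpace_fin, ← WithLp.toLp_smul, ← WithLp.toLp_sub]
    congr 1
    ext <;> simp
  have : f (p i) = WithLp.toLp 2 (p (σ i), (0 : ℝ)) := by
    change L (WithLp.toLp 2 (p i, (0 : ℝ))) = _
    rw [hdec, hdec, map_smul, map_sub, map_smul, hLe, hL]
  rw [this, WithLp.toLp_fst]

end RegularSimplex

/-! ### The two directions of the equality case. -/

namespace SphereMeasure

variable {n : ℕ} {Z : Measure (Metric.sphere (0 : EuclideanSpace ℝ (Fin n)) 1)}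
  [IsFiniteMeasure Z]

theorem hullSupport_eq_convexHull_range :
    hullSupport Z = convexHull ℝ (range fun ω : Z.support => (ω : EuclideanSpace ℝ (Fin n))) := by
  rw [hullSupport, image_id', image_eq_range]

theorem isInscribedRegularSimplex_of_lintegral_eq_one (hn : 1 ≤ n) (hiso : IsIsotropic Z)
    (hcen : centroid Z = 0)
    (heq : ∫⁻ x in dualCone (liftedSupport Z), ENNReal.ofReal
      (exp (-inner ℝ x (∫ ω, liftedSupport Z ω ∂supportMeasure Z))) = 1) :
    IsInscribedRegularSimplex (hullSupport Z) := by
  have := isOpenPosMeasure_supportMeasure (Z := Z) hn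
  have hfam := isIsotropicFamily_liftedSupport hn hiso hcen
  have hinj : Function.Injective (liftedSupport Z) :=
    (liftVec_injective hn).comp (Subtype.val_injective.comp Subtype.val_injective)
  have horth : Orthonormal ℝ (liftedSupport Z) := ⟨norm_liftedSupport, fun ω η hne =>
    inner_eq_zero_of_lintegral_dualCone_eq_one continuous_liftedSupport hfam norm_liftedSupport
      heq (hinj.ne hne)⟩
  -- Isotropy leaves no nonzero vector orthogonal to the family, so it is a basis and the support
  -- has `n + 1` points.
  have hbot : (Submodule.span ℝ (range (liftedSupport Z)))ᗮ = ⊥ := by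
    rw [Submodule.eq_bot_iff]
    intro x hx
    have h0 : ∀ ω, inner ℝ x (liftedSupport Z ω) = 0 := fun ω => by
      rw [real_inner_comm]
      exact (Submodule.mem_orthogonal _ _).1 hx _ (Submodule.subset_span (mem_range_self ω))
    have h1 := hfam x
    simp only [h0] at h1
    simpa using h1.symm
  have hfin : Finite Z.support := horth.linearIndependent.finite
  have := Fintype.ofFinite Z.support
  let b := OrthonormalBasis.mkOfOrthogonalEqBot horth hbot
  have hcard : Fintype.card Z.support = n + 1 := by
    rw [← Module.finrank_eq_card_basis b.toBasis, finrank_prod_real]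
  let σ := (Fintype.equivFinOfCardEq hcard).symm
  let p : Fin (n + 1) → EuclideanSpace ℝ (Fin n) := fun i => σ i
  have hp : Orthonormal ℝ fun i => liftVec (p i) := horth.comp σ σ.injective
  refine ⟨⟨p, affineIndependent_of_orthonormal_liftVec hp⟩, fun τ => ?_, fun i => (σ i).1.2, ?_⟩
  · obtain ⟨g, hg⟩ := exists_isometryEquiv_of_orthonormal_liftVec hn hp τ
    exact ⟨g, funext hg⟩
  · rw [hullSupport_eq_convexHull_range]
    congr 1
    exact (σ.surjective.range_comp fun ω : Z.support => (ω : EuclideanSpace ℝ (Fin n))).symm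

theorem lintegral_eq_one_of_isInscribedRegularSimplex (hn : 1 ≤ n) (hiso : IsIsotropic Z)
    (hcen : centroid Z = 0) (hreg : IsInscribedRegularSimplex (hullSupport Z)) :
    ∫⁻ x in dualCone (liftedSupport Z), ENNReal.ofReal
      (exp (-inner ℝ x (∫ ω, liftedSupport Z ω ∂supportMeasure Z))) = 1 := by
  obtain ⟨s, hs, hsph, hhull⟩ := hreg
  have hn0 : (0 : ℝ) < n := by exact_mod_cast hn
  have hnorm : ∀ i, ‖s.points i‖ = 1 := fun i => by simpa using hsph i
  rw [hullSupport_eq_convexHull_range] at hhull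
  have hS : (range fun ω : Z.support => (ω : EuclideanSpace ℝ (Fin n))) ⊆ Metric.sphere 0 1 := by
    rintro _ ⟨ω, rfl⟩
    exact ω.1.2
  have hT : range s.points ⊆ Metric.sphere 0 1 := by
    rintro _ ⟨i, rfl⟩
    exact hsph i
  have hrange : (range fun ω : Z.support => (ω : EuclideanSpace ℝ (Fin n))) = range s.points :=
    (subset_of_convexHull_eq_of_subset_sphere hS hT hhull).antisymm
      (subset_of_convexHull_eq_of_subset_sphere hT hS hhull.symm)
  obtain ⟨r, hr⟩ := hs.equilateral
  set α := 1 - r ^ 2 / 2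
  have hin : ∀ i j, i ≠ j → inner ℝ (s.points i) (s.points j) = α := by
    intro i j hij
    have h := norm_sub_sq_real (s.points i) (s.points j)
    rw [← dist_eq_norm, hr i j hij, hnorm, hnorm] at h
    simp only [α]
    linarith
  have hα : α = -1 / n := by
    -- The integrand is `(t - 1) * (t - α)` at `t = s.points 0 · u`, zero on every vertex; its
    -- integral is also `1 + n * α`.
    have h0 : ∫ u, ((inner ℝ (s.points 0) (u : EuclideanSpace ℝ (Fin n)) ^ 2 -
        (1 + α) * inner ℝ (s.points 0) (u : EuclideanSpace ℝ (Fin n))) + α) ∂Z = 0 := by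
      refine integral_eq_zero_of_ae ?_
      filter_upwards [Measure.support_mem_ae (μ := Z)] with u hu
      obtain ⟨i, hi⟩ := hrange.subset (mem_range_self (⟨u, hu⟩ : Z.support))
      dsimp only at hi
      rw [← hi]
      by_cases h : 0 = i
      · rw [← h, real_inner_self_eq_norm_sq, hnorm]
        simp
      · rw [hin 0 i h]
        simp only [Pi.zero_apply]
        ring
    rw [integral_add, integral_sub, integral_const_mul, integral_inner_coe_sq hiso,
      integral_inner_coe_eq_zero hn hiso hcen, integral_const, hiso.measureReal_univ, hnorm] at h0
    · rw [eq_div_iff hn0.ne']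
      simp only [smul_eq_mul] at h0
      linarith
    all_goals exact integrable_of_continuous (by fun_prop)
  have hp : Orthonormal ℝ fun i => liftVec (s.points i) := by
    refine ⟨fun i => norm_liftVec (hnorm i), fun i j hij => ?_⟩
    dsimp only
    rw [inner_liftVec_liftVec, hin i j hij, hα, finrank_euclideanSpace_fin]
    field_simp
    ring
  obtain ⟨b, hb⟩ := exists_orthonormalBasis_eq_liftVec hp
  have hcone : dualCone (liftedSupport Z) = dualCone b := by
    ext x
    simp only [dualCone, liftedSupport, hb]
    change (∀ ω : Z.support, 0 < inner ℝ x (liftVec (ω : EuclideanSpace ℝ (Fin n)))) ↔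
      ∀ i, 0 < inner ℝ x (liftVec (s.points i))
    rw [← forall_mem_range (f := fun ω : Z.support => (ω : EuclideanSpace ℝ (Fin n)))
      (p := fun v => 0 < inner ℝ x (liftVec v)), hrange, forall_mem_range]
  have hsum : ∫ ω, liftedSupport Z ω ∂supportMeasure Z = ∑ i, b i := by
    refine b.repr.injective ?_
    ext i
    rw [b.repr_apply_apply, b.repr_apply_apply, inner_integral_liftedSupport hn hiso hcen,
      inner_sum]
    have h0 : 0 < √((n : ℝ) + 1) := sqrt_pos.2 (by positivity)
    simp only [OrthonormalBasis.inner_eq_ite, Finset.sum_ite_eq, Finset.mem_univ, if_true]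
    rw [hb]
    simp only [liftVec, WithLp.toLp_snd, finrank_euclideanSpace_fin]
    field_simp
  rw [hcone, hsum, lintegral_dualCone_orthonormalBasis]

end SphereMeasure

theorem theorem1 (n : ℕ) (hn : 1 ≤ n)
    (Z : Measure (Metric.sphere (0 : EuclideanSpace ℝ (Fin n)) 1)) [IsFiniteMeasure Z]
    (hiso : SphereMeasure.IsIsotropic Z) (hcen : SphereMeasure.centroid Z = 0) :
    volume (polarBody (SphereMeasure.hullSupport Z)) ≤
        ENNReal.ofReal ((n : ℝ) ^ ((n : ℝ) / 2) * ((n : ℝ) + 1) ^ (((n : ℝ) + 1) / 2) /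
          (Nat.factorial n : ℝ)) ∧
      (volume (polarBody (SphereMeasure.hullSupport Z)) =
          ENNReal.ofReal ((n : ℝ) ^ ((n : ℝ) / 2) * ((n : ℝ) + 1) ^ (((n : ℝ) + 1) / 2) /
            (Nat.factorial n : ℝ)) ↔
        IsInscribedRegularSimplex (SphereMeasure.hullSupport Z)) := by
  have hle := lintegral_dualCone_le_one SphereMeasure.continuous_liftedSupport
    (SphereMeasure.isIsotropicFamily_liftedSupport hn hiso hcen) SphereMeasure.norm_liftedSupport
  have hvol := SphereMeasure.lintegral_dualCone_liftedSupport hn hiso hcen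
  have hn0 : (0 : ℝ) < n := by exact_mod_cast hn
  have hpos : 0 < (n : ℝ) ^ ((n : ℝ) / 2) * ((n : ℝ) + 1) ^ (((n : ℝ) + 1) / 2) /
      (Nat.factorial n : ℝ) := by positivity
  have hB0 := (ENNReal.ofReal_pos.2 hpos).ne'
  have hBtop := ENNReal.ofReal_ne_top (r := (n : ℝ) ^ ((n : ℝ) / 2) *
    ((n : ℝ) + 1) ^ (((n : ℝ) + 1) / 2) / (Nat.factorial n : ℝ))
  rw [← div_eq_mul_inv] at hvol
  refine ⟨?_, ?_⟩
  · rw [hvol, ENNReal.div_le_iff hB0 hBtop, one_mul] at hle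
    exact hle
  · rw [← ENNReal.div_eq_one_iff hB0 hBtop, ← hvol]
    exact ⟨SphereMeasure.isInscribedRegularSimplex_of_lintegral_eq_one hn hiso hcen,
      SphereMeasure.lintegral_eq_one_of_isInscribedRegularSimplex hn hiso hcen⟩

end
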